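/- Let $\theta\in\mathbb R$ be irrational and put $\lambda=e^{2\pi i\theta}$. Let $A$ be the free twist of two isometries, i.e. the universal (unital) $C^*$-algebra generated by two isometries $u,v$ (so $u^*u=v^*v=1$) subject to $uv=\lambda vu$: the Hausdorff completion of the unital $*$-algebra of non-commutative complex polynomials in $u,v,u^*,v^*$ with respect to the supremum of all $C^*$-seminorms vanishing on $u^*u-1$, $v^*v-1$ and $uv-\lambda vu$. Let $J=\langle 1-uu^*,\,1-vv^*\rangle$ be the closed two-sided ideal of $A$ generated by $1-uu^*$ and $1-vv^*$. Then every proper two-sided ideal $I\subsetneq A$ (closed or not) satisfies $I\subseteq J$. Moreover $J\neq A$; hence $J$ is the largest proper closed two-sided ideal of $A$. -/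

import Mathlib

open scoped ComplexConjugate

noncomputable section

namespace FreeTwist

/-- The generators `u`, `v` of the free twist together with their formal adjoints. -/
inductive Gen
  | u
  | v
  | uStar
  | vStar

/-- The formal adjoint of a generator. -/
def Gen.adj : Gen → Gen
  | .u => .uStar
  | .v => .vStar
  | .uStar => .u
  | .vStar => .v

/-- Non-commutative complex polynomials in `u`, `v`, `u*`, `v*`: the algebra of the free monoid
on these four letters. The parameter `θ` is not used in the algebraic structure; it serves to
carry the seminorm, which depends on `θ`. -/
@[nolint unusedArguments]
def Poly (_θ : ℝ) : Type := MonoidAlgebra ℂ (FreeMonoid Gen)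

variable {θ : ℝ}

instance : Ring (Poly θ) := inferInstanceAs (Ring (MonoidAlgebra ℂ (FreeMonoid Gen)))

instance : Algebra ℂ (Poly θ) := inferInstanceAs (Algebra ℂ (MonoidAlgebra ℂ (FreeMonoid Gen)))

/-- A monomial, as a polynomial. -/
def mono : FreeMonoid Gen →* Poly θ := MonoidAlgebra.of ℂ (FreeMonoid Gen)

/-- A letter, as a polynomial. -/
def letter (g : Gen) : Poly θ := mono (FreeMonoid.of g)

theorem poly_induction {P : Poly θ → Prop} (x : Poly θ) (mono : ∀ w, P (mono w))
    (add : ∀ x y, P x → P y → P (x + y)) (smul : ∀ (c : ℂ) x, P x → P (c • x)) : P x :=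
  MonoidAlgebra.induction_on (motive := P) x mono add smul

/-- The involution as a ring homomorphism into the opposite ring: it is conjugate linear, reverses
products, and sends each letter to its formal adjoint. -/
def starHom : Poly θ →+* (Poly θ)ᵐᵒᵖ :=
  MonoidAlgebra.liftNCRingHom ((algebraMap ℂ (Poly θ)ᵐᵒᵖ).comp (starRingEnd ℂ))
    (FreeMonoid.lift fun g => MulOpposite.op (letter g.adj))
    fun c _ => Algebra.commutes (A := (Poly θ)ᵐᵒᵖ) (conj c) _

theorem starHom_mono (w : FreeMonoid Gen) : starHom (mono w : Poly θ) =
    FreeMonoid.lift (fun g => MulOpposite.op (letter g.adj : Poly θ)) w := by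
  refine (MonoidAlgebra.liftNC_single _ _ _ _).trans ?_
  simp

theorem starHom_smul (c : ℂ) (x : Poly θ) : starHom (c • x) = conj c • starHom x := by
  have h : starHom (algebraMap ℂ (Poly θ) c) = algebraMap ℂ (Poly θ)ᵐᵒᵖ (conj c) := by
    refine (MonoidAlgebra.liftNC_single _ _ _ _).trans ?_
    simp
  rw [Algebra.smul_def, map_mul, h, Algebra.smul_def]

theorem starHom_starHom (x : Poly θ) : (starHom (starHom x).unop).unop = x := by
  induction x using poly_induction with
  | mono w =>
    induction w using FreeMonoid.inductionOn' with
    | one => simp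
    | of_mul g w ih =>
      have hg : (starHom (starHom (mono (FreeMonoid.of g) : Poly θ)).unop).unop
          = mono (FreeMonoid.of g) := by
        simp only [starHom_mono, FreeMonoid.lift_eval_of, MulOpposite.unop_op, letter]
        cases g <;> rfl
      simp only [map_mul, MulOpposite.unop_mul, ih, hg]
  | add x y hx hy => simp only [map_add, MulOpposite.unop_add, hx, hy]
  | smul c x hx => simp only [starHom_smul, MulOpposite.unop_smul, hx, Complex.conj_conj]

instance : StarRing (Poly θ) where
  star x := (starHom x).unop
  star_involutive := starHom_starHom
  star_mul x y := by simp
  star_add x y := by simp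

instance : StarModule ℂ (Poly θ) where
  star_smul c x := congrArg MulOpposite.unop (starHom_smul c x)

theorem star_letter (g : Gen) : star (letter g : Poly θ) = letter g.adj := by
  change (starHom (mono (FreeMonoid.of g))).unop = _
  simp [starHom_mono]

/-- The scalar `λ = exp(2πiθ)`. -/
def twist (θ : ℝ) : ℂ := Complex.exp (2 * Real.pi * Complex.I * θ)

/-- `p` is a C*-seminorm on the `*`-algebra with generators `u`, `v` and relations
`u*u = 1`, `v*v = 1`, `uv = λvu`, that is, a C*-seminorm on polynomials that vanishes on these
relations (equivalently, on the ideal that they generate). -/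
structure IsAdmissible (p : Seminorm ℂ (Poly θ)) : Prop where
  mul_le : ∀ x y, p (x * y) ≤ p x * p y
  star_mul_self : ∀ x, p (star x * x) = p x ^ 2
  isometry_u : p (star (letter .u) * letter .u - 1) = 0
  isometry_v : p (star (letter .v) * letter .v - 1) = 0
  commutation : p (letter .u * letter .v - twist θ • (letter .v * letter .u)) = 0

namespace IsAdmissible

variable {p : Seminorm ℂ (Poly θ)}

theorem zero : IsAdmissible (0 : Seminorm ℂ (Poly θ)) := by
  constructor <;> simp

theorem le_star (hp : IsAdmissible p) (x : Poly θ) : p x ≤ p (star x) := by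
  have h := hp.mul_le (star x) x
  rw [hp.star_mul_self] at h
  have h0 := apply_nonneg p x
  have h1 := apply_nonneg p (star x)
  by_contra! hlt
  nlinarith

theorem star_eq (hp : IsAdmissible p) (x : Poly θ) : p (star x) = p x :=
  le_antisymm (by simpa using hp.le_star (star x)) (hp.le_star x)

theorem one_le (hp : IsAdmissible p) : p 1 ≤ 1 := by
  have h := hp.star_mul_self 1
  simp only [star_one, mul_one] at h
  nlinarith [sq_nonneg (p 1 - 1)]

theorem isometry_le (hp : IsAdmissible p) {x : Poly θ} (hx : p (star x * x - 1) = 0) :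
    p x ≤ 1 := by
  have h : p (star x * x) ≤ p (star x * x - 1) + p 1 := by
    simpa using map_add_le_add p (star x * x - 1) 1
  rw [hp.star_mul_self, hx] at h
  nlinarith [hp.one_le]

theorem letter_le (hp : IsAdmissible p) (g : Gen) : p (letter g) ≤ 1 := by
  cases g with
  | u => exact hp.isometry_le hp.isometry_u
  | v => exact hp.isometry_le hp.isometry_v
  | uStar =>
    rw [← hp.star_eq, star_letter]
    exact hp.isometry_le hp.isometry_u
  | vStar =>
    rw [← hp.star_eq, star_letter]
    exact hp.isometry_le hp.isometry_v

theorem mono_le (hp : IsAdmissible p) (w : FreeMonoid Gen) : p (mono w) ≤ 1 := by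
  induction w using FreeMonoid.inductionOn' with
  | one => simpa using hp.one_le
  | of_mul g w ih =>
    rw [map_mul]
    exact (hp.mul_le _ _).trans (mul_le_one₀ (hp.letter_le g) (apply_nonneg p _) ih)

end IsAdmissible

theorem exists_bound (x : Poly θ) : ∃ C : ℝ, ∀ p, IsAdmissible p → p x ≤ C := by
  induction x using poly_induction with
  | mono w => exact ⟨1, fun p hp => hp.mono_le w⟩
  | add x y hx hy =>
    obtain ⟨C, hC⟩ := hx
    obtain ⟨D, hD⟩ := hy
    exact ⟨C + D, fun p hp => (map_add_le_add p x y).trans (add_le_add (hC p hp) (hD p hp))⟩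
  | smul c x hx =>
    obtain ⟨C, hC⟩ := hx
    refine ⟨‖c‖ * C, fun p hp => ?_⟩
    rw [map_smul_eq_mul]
    exact mul_le_mul_of_nonneg_left (hC p hp) (norm_nonneg c)

/-- The universal C*-seminorm: the supremum of all admissible C*-seminorms. -/
def univNorm (x : Poly θ) : ℝ := sSup {r | ∃ p : Seminorm ℂ (Poly θ), IsAdmissible p ∧ r = p x}

theorem le_univNorm {p : Seminorm ℂ (Poly θ)} (hp : IsAdmissible p) (x : Poly θ) :
    p x ≤ univNorm x := by
  obtain ⟨C, hC⟩ := exists_bound x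
  exact le_csSup ⟨C, by rintro _ ⟨q, hq, rfl⟩; exact hC q hq⟩ ⟨p, hp, rfl⟩

theorem univNorm_le {x : Poly θ} {C : ℝ} (h : ∀ p, IsAdmissible p → p x ≤ C) :
    univNorm x ≤ C :=
  csSup_le ⟨_, 0, .zero, rfl⟩ (by rintro _ ⟨q, hq, rfl⟩; exact h q hq)

theorem univNorm_nonneg (x : Poly θ) : 0 ≤ univNorm x := le_univNorm .zero x

theorem univNorm_star_mul_self_ge (x : Poly θ) :
    univNorm x * univNorm x ≤ univNorm (star x * x) := by
  have h : univNorm x ≤ √(univNorm (star x * x)) := univNorm_le fun p hp =>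
    Real.le_sqrt_of_sq_le (by rw [← hp.star_mul_self]; exact le_univNorm hp _)
  calc univNorm x * univNorm x ≤ √(univNorm (star x * x)) * √(univNorm (star x * x)) :=
        mul_self_le_mul_self (univNorm_nonneg x) h
    _ = _ := Real.mul_self_sqrt (univNorm_nonneg _)

/-- The universal C*-seminorm as a ring seminorm. -/
def univRingSeminorm (θ : ℝ) : RingSeminorm (Poly θ) where
  toFun := univNorm
  map_zero' := le_antisymm (univNorm_le fun p _ => (map_zero p).le) (univNorm_nonneg 0)
  add_le' x y := univNorm_le fun p hp =>
    (map_add_le_add p x y).trans (add_le_add (le_univNorm hp x) (le_univNorm hp y))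
  neg' x := by simp only [univNorm, map_neg_eq_map]
  mul_le' x y := univNorm_le fun p hp => (hp.mul_le x y).trans
    (mul_le_mul (le_univNorm hp x) (le_univNorm hp y) (apply_nonneg p y) (univNorm_nonneg x))

/-- Polynomials carry the universal C*-seminorm. -/
instance : SeminormedRing (Poly θ) := (univRingSeminorm θ).toSeminormedRing

theorem norm_def (x : Poly θ) : ‖x‖ = univNorm x := rfl

instance : NormedSpace ℂ (Poly θ) where
  norm_smul_le c x := univNorm_le fun p hp => by
    rw [map_smul_eq_mul]
    exact mul_le_mul_of_nonneg_left (le_univNorm hp x) (norm_nonneg c)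

instance : NormedStarGroup (Poly θ) where
  norm_star_le x := univNorm_le fun p hp => by
    rw [hp.star_eq]
    exact le_univNorm hp x

end FreeTwist

open FreeTwist UniformSpace

/-- The free twist of two isometries: the universal C*-algebra generated by two isometries `u`, `v`
with `uv = exp(2πiθ)vu`. It is the Hausdorff completion of the polynomials for the universal
C*-seminorm (that is, the completion of their quotient by its null space). -/
def FreeTwist (θ : ℝ) : Type := Completion (Poly θ)

namespace FreeTwist

variable {θ : ℝ}

instance : NormedRing (FreeTwist θ) := inferInstanceAs (NormedRing (Completion (Poly θ)))

instance : CompleteSpace (FreeTwist θ) := inferInstanceAs (CompleteSpace (Completion (Poly θ)))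

instance : NormedAlgebra ℂ (FreeTwist θ) where
  toAlgebra := inferInstanceAs (Algebra ℂ (Completion (Poly θ)))
  norm_smul_le c x := norm_smul_le (β := Completion (Poly θ)) c x

/-- The canonical homomorphism from polynomials to the free twist. -/
def ofPoly : Poly θ →ₐ[ℂ] FreeTwist θ where
  toRingHom := Completion.coeRingHom (α := Poly θ)
  commutes' _ := rfl

theorem norm_ofPoly (x : Poly θ) : ‖ofPoly x‖ = ‖x‖ := Completion.norm_coe x

theorem denseRange_ofPoly : DenseRange (ofPoly : Poly θ → FreeTwist θ) :=
  Completion.denseRange_coe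

theorem uniformContinuous_star_poly : UniformContinuous (star : Poly θ → Poly θ) :=
  (starNormedAddGroupHom (E := Poly θ)).uniformContinuous

/-- The involution on the free twist is the continuous extension of that on polynomials. -/
instance : Star (FreeTwist θ) where
  star := Completion.map (star : Poly θ → Poly θ)

theorem star_ofPoly (x : Poly θ) : star (ofPoly x) = ofPoly (star x) :=
  Completion.map_coe uniformContinuous_star_poly x

theorem continuous_star_freeTwist : Continuous (star : FreeTwist θ → FreeTwist θ) :=
  Completion.continuous_map

theorem poly_dense_induction {P : FreeTwist θ → Prop} (x : FreeTwist θ) (hc : IsClosed {x | P x})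
    (h : ∀ y : Poly θ, P (ofPoly y)) : P x :=
  denseRange_ofPoly.induction_on x hc h

theorem poly_dense_induction_two {P : FreeTwist θ → FreeTwist θ → Prop} (x y : FreeTwist θ)
    (hc : IsClosed {z : FreeTwist θ × FreeTwist θ | P z.1 z.2})
    (h : ∀ a b : Poly θ, P (ofPoly a) (ofPoly b)) : P x y :=
  denseRange_ofPoly.induction_on₂ hc h x y

instance : StarRing (FreeTwist θ) where
  star_involutive x := by
    refine poly_dense_induction (P := fun x => star (star x) = x) x ?_ ?_
    · exact isClosed_eq (continuous_star_freeTwist.comp continuous_star_freeTwist) continuous_id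
    · intro y
      rw [star_ofPoly, star_ofPoly, star_star]
  star_mul x y := by
    refine poly_dense_induction_two (P := fun x y => star (x * y) = star y * star x) x y ?_ ?_
    · exact isClosed_eq (continuous_star_freeTwist.comp continuous_mul)
        ((continuous_star_freeTwist.comp continuous_snd).mul
          (continuous_star_freeTwist.comp continuous_fst))
    · intro a b
      rw [← map_mul, star_ofPoly, star_ofPoly, star_ofPoly, star_mul, map_mul]
  star_add x y := by
    refine poly_dense_induction_two (P := fun x y => star (x + y) = star x + star y) x y ?_ ?_
    · exact isClosed_eq (continuous_star_freeTwist.comp continuous_add)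
        ((continuous_star_freeTwist.comp continuous_fst).add
          (continuous_star_freeTwist.comp continuous_snd))
    · intro a b
      rw [← map_add, star_ofPoly, star_ofPoly, star_ofPoly, star_add, map_add]

instance : CStarAlgebra (FreeTwist θ) where
  norm_mul_self_le x := by
    refine poly_dense_induction (P := fun x => ‖x‖ * ‖x‖ ≤ ‖star x * x‖) x ?_ ?_
    · exact isClosed_le (continuous_norm.mul continuous_norm)
        (continuous_star_freeTwist.mul continuous_id).norm
    · intro y
      rw [star_ofPoly, ← map_mul, norm_ofPoly, norm_ofPoly]
      exact univNorm_star_mul_self_ge y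
  star_smul c x := by
    refine poly_dense_induction (P := fun x => star (c • x) = star c • star x) x ?_ ?_
    · exact isClosed_eq (continuous_star_freeTwist.comp (continuous_const_smul c))
        (continuous_star_freeTwist.const_smul (star c))
    · intro y
      rw [← map_smul, star_ofPoly, star_ofPoly, star_smul, map_smul]

/-- The first canonical generator of the free twist. -/
def u (θ : ℝ) : FreeTwist θ := ofPoly (letter .u)

/-- The second canonical generator of the free twist. -/
def v (θ : ℝ) : FreeTwist θ := ofPoly (letter .v)

end FreeTwist

/-- The closed two-sided ideal generated by a set: the intersection of all closed two-sided ideals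
that contain it. -/
def closedIdealSpan {A : Type*} [NormedRing A] (s : Set A) : TwoSidedIdeal A :=
  sInf {I : TwoSidedIdeal A | IsClosed (I : Set A) ∧ s ⊆ I}

/-- The ideal `J = ⟨1 - uu*, 1 - vv*⟩` of the free twist. -/
def defectIdeal (θ : ℝ) : TwoSidedIdeal (FreeTwist θ) :=
  closedIdealSpan {1 - FreeTwist.u θ * star (FreeTwist.u θ), 1 - FreeTwist.v θ * star (FreeTwist.v θ)}

end

/-! Put `w = uv`, an isometry. Since `uv` and `vu` agree up to a phase, its range lies under both
`uu*` and `vv*`, so right multiplication by `w` kills both defects. The decreasing limit `asympNorm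
x` of `‖x wⁿ‖` is a seminorm whose null space is a closed two-sided ideal, and this ideal is `J`
(`defectIdeal_eq_nullIdeal`): if `‖x wⁿ‖ → 0`, then `x` is the limit of the elements `x(1 - wⁿwⁿ*)`
of `J`. As `‖wⁿ‖ = 1`, `asympNorm 1 = 1` and `J` is proper.

Modulo `J` the generators are unitaries, and each monomial is a scalar multiple of some `uᵖv^q`.
Compression by `uᵐvⁿ` multiplies it by `λ^(np - mq)`. As `λ` is not a root of unity, the averages of
these compressions bring every element close to the scalars (`exists_eventually_wordAverage`). For
`x` outside `J`, the averages of `x*x` also stay away from zero: the orbit is totally bounded, so a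
fixed proportion of the compressions cluster around one element that is not small, and the other
summands, being positive, cannot cancel them (`exists_pos_le_asympNorm_wordAverage`).

Hence an ideal `I` containing such an `x` contains an element whose `asympNorm` distance to some `t
• 1` is less than `‖t‖`. Compressing by a high power of `w` makes this an estimate in norm, and a
Neumann series gives an invertible element of `I` (`eq_top_of_asympNorm_sub_smul_lt`). No limit is
taken inside `I`, so `I` need not be closed. -/

open Filter Topology

noncomputable section

namespace FreeTwist

/-! ### Admissible seminorms from concrete representations -/

section Representation

variable {θ : ℝ} {B : Type*} [CStarAlgebra B]

/-- The homomorphism from polynomials that sends the letters to given elements. -/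
def polyLift (a b : B) : Poly θ →ₐ[ℂ] B :=
  MonoidAlgebra.lift ℂ B (FreeMonoid Gen) (FreeMonoid.lift fun
    | .u => a
    | .v => b
    | .uStar => star a
    | .vStar => star b)

theorem polyLift_mono (a b : B) (m : FreeMonoid Gen) :
    polyLift a b (mono m : Poly θ) = FreeMonoid.lift (fun
    | .u => a
    | .v => b
    | .uStar => star a
    | .vStar => star b) m :=
  MonoidAlgebra.lift_of _ _

theorem polyLift_star (a b : B) (x : Poly θ) : polyLift a b (star x) = star (polyLift a b x) := by
  induction x using poly_induction with
  | mono m =>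
    induction m using FreeMonoid.inductionOn' with
    | one => simp
    | of_mul g m ih =>
      have hg : polyLift a b (star (letter g : Poly θ)) = star (polyLift a b (letter g : Poly θ)) := by
        rw [star_letter, letter, letter, polyLift_mono, polyLift_mono, FreeMonoid.lift_eval_of,
          FreeMonoid.lift_eval_of]
        cases g <;> simp [Gen.adj]
      rw [map_mul, star_mul, map_mul, ih, map_mul, star_mul]
      exact congrArg _ hg
  | add x y hx hy => simp only [star_add, map_add, hx, hy]
  | smul c x hx => simp only [star_smul, map_smul, hx]

/-- The C*-seminorm that a representation induces. -/
def repSeminorm (a b : B) : Seminorm ℂ (Poly θ) :=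
  (normSeminorm ℂ B).comp (polyLift a b : Poly θ →ₐ[ℂ] B).toLinearMap

theorem repSeminorm_apply (a b : B) (x : Poly θ) : repSeminorm a b x = ‖polyLift a b x‖ := rfl

theorem isAdmissible_repSeminorm {a b : B} (ha : star a * a = 1) (hb : star b * b = 1)
    (hab : a * b = twist θ • (b * a)) : IsAdmissible (repSeminorm (θ := θ) a b) where
  mul_le x y := by simpa only [repSeminorm_apply, map_mul] using norm_mul_le _ _
  star_mul_self x := by
    simp only [repSeminorm_apply, map_mul, polyLift_star, CStarRing.norm_star_mul_self, sq]
  isometry_u := by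
    simp [repSeminorm_apply, polyLift_star, letter, polyLift_mono, ha]
  isometry_v := by
    simp [repSeminorm_apply, polyLift_star, letter, polyLift_mono, hb]
  commutation := by
    simp [repSeminorm_apply, letter, polyLift_mono, hab]

/-- A single representation on a nonzero C*-algebra gives an admissible seminorm with value 1 at the
unit, which bounds the universal norm from below. -/
theorem one_ne_zero_of_rep [Nontrivial B] {a b : B} (ha : star a * a = 1) (hb : star b * b = 1)
    (hab : a * b = twist θ • (b * a)) : (1 : FreeTwist θ) ≠ 0 := by
  intro h
  have h1 := le_univNorm (isAdmissible_repSeminorm ha hb hab) 1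
  rw [← norm_def, ← norm_ofPoly, map_one ofPoly, h, norm_zero, repSeminorm_apply,
    map_one (polyLift a b), CStarRing.norm_one] at h1
  exact absurd h1 (by norm_num)

end Representation

/-! ### A model on `ℓ²(ℤ)`, showing that the algebra is nonzero -/

section RotationModel

/-- The square summable sequences indexed by the integers. -/
abbrev SeqSpace : Type := lp (fun _ : ℤ => ℂ) 2

theorem norm_seq_eq_of_sum_eq {f g : SeqSpace} (h : ∑' n, ‖f n‖ ^ 2 = ∑' n, ‖g n‖ ^ 2) :
    ‖f‖ = ‖g‖ := by
  have h2 : 0 < (2 : ENNReal).toReal := by norm_num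
  rw [lp.norm_eq_tsum_rpow h2, lp.norm_eq_tsum_rpow h2]
  simp [h]

theorem summable_sq_seq (f : SeqSpace) : Summable fun n => ‖f n‖ ^ 2 := by
  simpa using (lp.memℓp f).summable (by norm_num)

theorem memℓp_of_summable_sq {f : ℤ → ℂ} (h : Summable fun n => ‖f n‖ ^ 2) :
    Memℓp f 2 :=
  memℓp_gen (by simpa using h)

/-- The bilateral shift. -/
def shiftIso : SeqSpace →ₗᵢ[ℂ] SeqSpace where
  toFun f := ⟨fun n => f (n - 1), memℓp_of_summable_sq
    ((Equiv.subRight (1 : ℤ)).summable_iff.mpr (summable_sq_seq f))⟩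
  map_add' _ _ := rfl
  map_smul' _ _ := rfl
  norm_map' f := norm_seq_eq_of_sum_eq
    ((Equiv.subRight (1 : ℤ)).tsum_eq fun n => ‖f n‖ ^ 2)

theorem norm_twist (θ : ℝ) : ‖twist θ‖ = 1 := by
  have h : twist θ = Complex.exp ((2 * Real.pi * θ : ℝ) * Complex.I) := by
    rw [twist]
    congr 1
    push_cast
    ring
  rw [h, Complex.norm_exp_ofReal_mul_I]

theorem twist_ne_zero (θ : ℝ) : twist θ ≠ 0 := Complex.exp_ne_zero _

/-- The diagonal unitary whose entries are the powers of the twist. -/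
def diagIso (θ : ℝ) : SeqSpace →ₗᵢ[ℂ] SeqSpace where
  toFun f := ⟨fun n => twist θ ^ n * f n, memℓp_of_summable_sq (by
    simpa [norm_twist] using summable_sq_seq f)⟩
  map_add' f g := by
    ext n
    exact mul_add _ _ _
  map_smul' c f := by
    ext n
    exact mul_left_comm _ _ _
  norm_map' f := norm_seq_eq_of_sum_eq (by simp [norm_twist])

theorem star_mul_self_of_isometry (T : SeqSpace →ₗᵢ[ℂ] SeqSpace) :
    star T.toContinuousLinearMap * T.toContinuousLinearMap = 1 :=
  (ContinuousLinearMap.norm_map_iff_adjoint_comp_self _).mp T.norm_map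

theorem diag_mul_shift (θ : ℝ) :
    (diagIso θ).toContinuousLinearMap * shiftIso.toContinuousLinearMap =
      twist θ • (shiftIso.toContinuousLinearMap * (diagIso θ).toContinuousLinearMap) := by
  ext f n
  change twist θ ^ n * f (n - 1) = twist θ * (twist θ ^ (n - 1) * f (n - 1))
  rw [← mul_assoc, ← zpow_one_add₀ (twist_ne_zero θ), add_sub_cancel]

instance : Nontrivial SeqSpace :=
  ⟨lp.single 2 0 1, 0, fun h => by simpa using congrArg (fun f : SeqSpace => f 0) h⟩

end RotationModel

instance (θ : ℝ) : Nontrivial (FreeTwist θ) :=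
  ⟨1, 0, one_ne_zero_of_rep (star_mul_self_of_isometry (diagIso θ))
    (star_mul_self_of_isometry shiftIso) (diag_mul_shift θ)⟩

/-! ### The defining relations in the completion -/

section Relations

variable {θ : ℝ}

theorem ofPoly_eq_zero {x : Poly θ} (h : ∀ p, IsAdmissible p → p x = 0) : ofPoly x = 0 := by
  rw [← norm_le_zero_iff, norm_ofPoly]
  exact univNorm_le fun p hp => (h p hp).le

variable (θ) in
theorem star_u_mul_u : star (u θ) * u θ = 1 := by
  rw [u, star_ofPoly, ← map_mul, ← sub_eq_zero, ← map_one ofPoly, ← map_sub]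
  exact ofPoly_eq_zero fun p hp => hp.isometry_u

variable (θ) in
theorem star_v_mul_v : star (v θ) * v θ = 1 := by
  rw [v, star_ofPoly, ← map_mul, ← sub_eq_zero, ← map_one ofPoly, ← map_sub]
  exact ofPoly_eq_zero fun p hp => hp.isometry_v

variable (θ) in
theorem u_mul_v : u θ * v θ = twist θ • (v θ * u θ) := by
  rw [u, v, ← map_mul, ← map_mul, ← map_smul, ← sub_eq_zero, ← map_sub]
  exact ofPoly_eq_zero fun p hp => hp.commutation

theorem norm_ofPoly_mono_le (m : FreeMonoid Gen) : ‖ofPoly (mono m : Poly θ)‖ ≤ 1 := by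
  rw [norm_ofPoly]
  exact univNorm_le fun p hp => hp.mono_le m

theorem norm_eq_one_of_isometry {a : FreeTwist θ} (h : star a * a = 1) : ‖a‖ = 1 := by
  have h1 : ‖a‖ * ‖a‖ = 1 := by rw [← CStarRing.norm_star_mul_self, h, CStarRing.norm_one]
  nlinarith [norm_nonneg a]

end Relations

/-! ### The asymptotic norm -/

variable {θ : ℝ}

/-- The isometry `uv`. -/
def uv (θ : ℝ) : FreeTwist θ := u θ * v θ

variable (θ) in
theorem star_uv_mul_uv : star (uv θ) * uv θ = 1 := by
  rw [uv, star_mul, mul_assoc, ← mul_assoc (star (u θ)), star_u_mul_u, one_mul, star_v_mul_v]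

theorem star_pow_mul_pow {a : FreeTwist θ} (h : star a * a = 1) (n : ℕ) :
    star (a ^ n) * a ^ n = 1 := by
  induction n with
  | zero => simp
  | succ n ih => rw [pow_succ, star_mul, mul_assoc, ← mul_assoc (star (a ^ n)), ih, one_mul, h]

variable (θ) in
theorem star_uv_pow_mul_uv_pow (n : ℕ) : star (uv θ ^ n) * uv θ ^ n = 1 :=
  star_pow_mul_pow (star_uv_mul_uv θ) n

theorem norm_star_isometry {a : FreeTwist θ} (h : star a * a = 1) : ‖star a‖ = 1 := by
  rw [norm_star, norm_eq_one_of_isometry h]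

theorem norm_mul_isometry_le {a : FreeTwist θ} (h : star a * a = 1) (x : FreeTwist θ) :
    ‖x * a‖ ≤ ‖x‖ := by
  simpa [norm_eq_one_of_isometry h] using norm_mul_le x a

/-- The limit of `‖x(uv)ⁿ‖`. It turns out to be the norm of the class of `x` modulo the defect
ideal. -/
def asympNorm (x : FreeTwist θ) : ℝ := ⨅ n : ℕ, ‖x * uv θ ^ n‖

theorem antitone_norm_mul_pow (x : FreeTwist θ) : Antitone fun n : ℕ => ‖x * uv θ ^ n‖ :=
  antitone_nat_of_succ_le fun n => by
    rw [pow_succ, ← mul_assoc]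
    exact norm_mul_isometry_le (star_uv_mul_uv θ) _

theorem bddBelow_norm_mul_pow (x : FreeTwist θ) :
    BddBelow (Set.range fun n : ℕ => ‖x * uv θ ^ n‖) :=
  ⟨0, by rintro _ ⟨n, rfl⟩; exact norm_nonneg _⟩

theorem tendsto_asympNorm (x : FreeTwist θ) :
    Tendsto (fun n : ℕ => ‖x * uv θ ^ n‖) atTop (𝓝 (asympNorm x)) :=
  tendsto_atTop_ciInf (antitone_norm_mul_pow x) (bddBelow_norm_mul_pow x)

theorem asympNorm_le_norm_mul_pow (x : FreeTwist θ) (n : ℕ) : asympNorm x ≤ ‖x * uv θ ^ n‖ :=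
  ciInf_le (bddBelow_norm_mul_pow x) n

theorem le_asympNorm {x : FreeTwist θ} {c : ℝ} (h : ∀ n, c ≤ ‖x * uv θ ^ n‖) : c ≤ asympNorm x :=
  le_ciInf h

theorem asympNorm_le_norm (x : FreeTwist θ) : asympNorm x ≤ ‖x‖ := by
  simpa using asympNorm_le_norm_mul_pow x 0

theorem asympNorm_nonneg (x : FreeTwist θ) : 0 ≤ asympNorm x := le_asympNorm fun _ => norm_nonneg _

theorem asympNorm_add_le (x y : FreeTwist θ) : asympNorm (x + y) ≤ asympNorm x + asympNorm y :=
  le_of_tendsto_of_tendsto' (tendsto_asympNorm _) ((tendsto_asympNorm x).add (tendsto_asympNorm y))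
    fun n => by rw [add_mul]; exact norm_add_le _ _

theorem asympNorm_smul (c : ℂ) (x : FreeTwist θ) : asympNorm (c • x) = ‖c‖ * asympNorm x :=
  tendsto_nhds_unique (tendsto_asympNorm _) <| by
    simpa only [smul_mul_assoc, norm_smul] using (tendsto_asympNorm x).const_mul ‖c‖

/-- The asymptotic norm as a seminorm. -/
def asympSeminorm (θ : ℝ) : Seminorm ℂ (FreeTwist θ) :=
  Seminorm.of asympNorm asympNorm_add_le asympNorm_smul

theorem asympNorm_zero : asympNorm (0 : FreeTwist θ) = 0 := map_zero (asympSeminorm θ)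

theorem asympNorm_neg (x : FreeTwist θ) : asympNorm (-x) = asympNorm x :=
  map_neg_eq_map (asympSeminorm θ) x

theorem asympNorm_sub_rev (x y : FreeTwist θ) : asympNorm (x - y) = asympNorm (y - x) :=
  map_sub_rev (asympSeminorm θ) x y

theorem asympNorm_le_add (x y : FreeTwist θ) : asympNorm x ≤ asympNorm y + asympNorm (x - y) := by
  simpa using asympNorm_add_le y (x - y)

theorem asympNorm_sum_le {ι : Type*} (s : Finset ι) (f : ι → FreeTwist θ) :
    asympNorm (∑ i ∈ s, f i) ≤ ∑ i ∈ s, asympNorm (f i) :=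
  Finset.le_sum_of_subadditive asympNorm asympNorm_zero.le asympNorm_add_le s f

theorem asympNorm_eq_of_sub {x y : FreeTwist θ} (h : asympNorm (x - y) = 0) :
    asympNorm x = asympNorm y :=
  le_antisymm (by simpa [h] using asympNorm_le_add x y)
    (by simpa [asympNorm_sub_rev y x, h] using asympNorm_le_add y x)

variable (θ) in
theorem asympNorm_one : asympNorm (1 : FreeTwist θ) = 1 :=
  tendsto_nhds_unique (tendsto_asympNorm _) <| by
    simpa only [one_mul, norm_eq_one_of_isometry (star_uv_pow_mul_uv_pow θ _)] using
      tendsto_const_nhds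

theorem continuous_asympNorm : Continuous (asympNorm : FreeTwist θ → ℝ) := by
  refine (LipschitzWith.of_dist_le_mul (K := 1) fun x y => ?_).continuous
  rw [NNReal.coe_one, one_mul, Real.dist_eq, dist_eq_norm]
  exact (abs_sub_map_le_sub (asympSeminorm θ) x y).trans (asympNorm_le_norm _)

theorem asympNorm_mul_le (h x : FreeTwist θ) : asympNorm (h * x) ≤ ‖h‖ * asympNorm x :=
  le_of_tendsto_of_tendsto' (tendsto_asympNorm _) ((tendsto_asympNorm x).const_mul ‖h‖)
    fun n => by rw [mul_assoc]; exact norm_mul_le _ _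

theorem asympNorm_mul_uv_pow (x : FreeTwist θ) (k : ℕ) :
    asympNorm (x * uv θ ^ k) = asympNorm x := by
  refine tendsto_nhds_unique (tendsto_asympNorm _) ?_
  simpa only [mul_assoc, ← pow_add, add_comm k] using
    (tendsto_add_atTop_iff_nat k).mpr (tendsto_asympNorm x)

theorem asympNorm_mul_uv (x : FreeTwist θ) : asympNorm (x * uv θ) = asympNorm x := by
  simpa using asympNorm_mul_uv_pow x 1

theorem uv_eq_smul : uv θ = twist θ • (v θ * u θ) := u_mul_v θ

theorem uv_mul_u : uv θ * u θ = (twist θ)⁻¹ • (u θ * uv θ) := by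
  rw [eq_inv_smul_iff₀ (twist_ne_zero θ), uv, mul_assoc, u_mul_v, mul_smul_comm]

theorem uv_mul_v : uv θ * v θ = twist θ • (v θ * uv θ) := by
  rw [uv, ← mul_assoc, ← smul_mul_assoc, ← u_mul_v]

theorem exists_pow_mul_comm {a : FreeTwist θ} {c : ℂ} (hc : ‖c‖ = 1)
    (h : uv θ * a = c • (a * uv θ)) (n : ℕ) :
    ∃ d : ℂ, ‖d‖ = 1 ∧ a * uv θ ^ n = d • (uv θ ^ n * a) := by
  induction n with
  | zero => exact ⟨1, by simp, by simp⟩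
  | succ n ih =>
    obtain ⟨d, hd, hn⟩ := ih
    have hc0 : c ≠ 0 := by
      rintro rfl
      simp at hc
    refine ⟨d * c⁻¹, by simp [hc, hd], ?_⟩
    have h' : a * uv θ = c⁻¹ • (uv θ * a) := by rw [eq_inv_smul_iff₀ hc0, h]
    rw [pow_succ, ← mul_assoc, hn, smul_mul_assoc, mul_assoc, h', mul_smul_comm, smul_smul,
      mul_assoc]

/-- Moving `a` to the right of `(uv)ⁿ` costs only a phase, and right multiplication by an isometry
does not increase the norm. -/
theorem asympNorm_mul_isometry_le {a : FreeTwist θ} (ha : star a * a = 1) {c : ℂ} (hc : ‖c‖ = 1)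
    (h : uv θ * a = c • (a * uv θ)) (x : FreeTwist θ) : asympNorm (x * a) ≤ asympNorm x :=
  le_asympNorm fun n => by
    obtain ⟨d, hd, hn⟩ := exists_pow_mul_comm hc h n
    refine (asympNorm_le_norm_mul_pow _ n).trans ?_
    rw [mul_assoc, hn, mul_smul_comm, norm_smul, hd, one_mul, ← mul_assoc]
    exact norm_mul_isometry_le ha _

theorem asympNorm_mul_u_le (x : FreeTwist θ) : asympNorm (x * u θ) ≤ asympNorm x :=
  asympNorm_mul_isometry_le (star_u_mul_u θ) (by simp [norm_twist]) uv_mul_u x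

theorem asympNorm_mul_v_le (x : FreeTwist θ) : asympNorm (x * v θ) ≤ asympNorm x :=
  asympNorm_mul_isometry_le (star_v_mul_v θ) (norm_twist θ) uv_mul_v x

theorem asympNorm_mul_u (x : FreeTwist θ) : asympNorm (x * u θ) = asympNorm x := by
  refine le_antisymm (asympNorm_mul_u_le x) ?_
  rw [← asympNorm_mul_uv x, uv, ← mul_assoc]
  exact asympNorm_mul_v_le _

theorem asympNorm_mul_v (x : FreeTwist θ) : asympNorm (x * v θ) = asympNorm x := by
  refine le_antisymm (asympNorm_mul_v_le x) ?_
  rw [← asympNorm_mul_uv x, uv_eq_smul, mul_smul_comm, asympNorm_smul, norm_twist, one_mul,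
    ← mul_assoc]
  exact asympNorm_mul_u_le _

/-- A further factor `uv` on the right is free and absorbs the adjoint: `u*(uv) = v`. For `v*` the
same works with `uv` rewritten as a multiple of `vu`. -/
theorem asympNorm_mul_star_u (x : FreeTwist θ) : asympNorm (x * star (u θ)) = asympNorm x := by
  rw [← asympNorm_mul_uv, uv, mul_assoc, ← mul_assoc (star _), star_u_mul_u, one_mul,
    asympNorm_mul_v]

theorem asympNorm_mul_star_v (x : FreeTwist θ) : asympNorm (x * star (v θ)) = asympNorm x := by
  rw [← asympNorm_mul_uv, uv_eq_smul, mul_smul_comm, asympNorm_smul, norm_twist, one_mul,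
    mul_assoc, ← mul_assoc (star _), star_v_mul_v, one_mul, asympNorm_mul_u]

theorem asympNorm_mul_ofPoly_mono (x : FreeTwist θ) (m : FreeMonoid Gen) :
    asympNorm (x * ofPoly (mono m)) = asympNorm x := by
  induction m using FreeMonoid.inductionOn' generalizing x with
  | one => simp
  | of_mul g m ih =>
    rw [map_mul, map_mul, ← mul_assoc, ih]
    cases g with
    | u => exact asympNorm_mul_u x
    | v => exact asympNorm_mul_v x
    | uStar =>
      rw [← asympNorm_mul_star_u x, u, star_ofPoly, star_letter]
      rfl
    | vStar =>
      rw [← asympNorm_mul_star_v x, v, star_ofPoly, star_letter]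
      rfl

/-- Only left multiplication is bounded directly from the definition. On the right, monomials
preserve `asympNorm`; linearity and continuity then extend the vanishing to all `y`. -/
theorem asympNorm_mul_eq_zero {x : FreeTwist θ} (hx : asympNorm x = 0) (y : FreeTwist θ) :
    asympNorm (x * y) = 0 := by
  refine poly_dense_induction (P := fun y => asympNorm (x * y) = 0) y
    (isClosed_eq (continuous_asympNorm.comp (continuous_const.mul continuous_id))
      continuous_const) fun p => ?_
  induction p using poly_induction with
  | mono m => rw [asympNorm_mul_ofPoly_mono, hx]
  | add p q hp hq =>
    refine le_antisymm ?_ (asympNorm_nonneg _)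
    rw [map_add, mul_add, ← add_zero (0 : ℝ)]
    exact (asympNorm_add_le _ _).trans (add_le_add hp.le hq.le)
  | smul c p hp => rw [map_smul, mul_smul_comm, asympNorm_smul, hp, mul_zero]

/-! ### The null ideal and its identification with the defect ideal -/

/-- The null space of the asymptotic norm, as a two-sided ideal. -/
def nullIdeal (θ : ℝ) : TwoSidedIdeal (FreeTwist θ) :=
  .mk' {x | asympNorm x = 0} asympNorm_zero
    (fun {x y} hx hy => le_antisymm ((asympNorm_add_le x y).trans (by
      rw [Set.mem_ofPred_eq] at hx hy
      rw [hx, hy, add_zero])) (asympNorm_nonneg _))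
    (fun {x} hx => (asympNorm_neg x).trans hx)
    (fun {x y} hy => le_antisymm ((asympNorm_mul_le x y).trans (by
      rw [Set.mem_ofPred_eq] at hy
      rw [hy, mul_zero])) (asympNorm_nonneg _))
    (fun {x y} hx => asympNorm_mul_eq_zero hx y)

theorem mem_nullIdeal {x : FreeTwist θ} : x ∈ nullIdeal θ ↔ asympNorm x = 0 :=
  TwoSidedIdeal.mem_mk' ..

theorem isClosed_nullIdeal : IsClosed (nullIdeal θ : Set (FreeTwist θ)) := by
  have h : (nullIdeal θ : Set (FreeTwist θ)) = {x | asympNorm x = 0} :=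
    Set.ext fun x => mem_nullIdeal
  rw [h]
  exact isClosed_eq continuous_asympNorm continuous_const

theorem one_sub_mul_star_u_mem : 1 - u θ * star (u θ) ∈ nullIdeal θ := by
  rw [mem_nullIdeal, ← asympNorm_mul_uv, uv, sub_mul, one_mul, mul_assoc (u θ),
    ← mul_assoc (star (u θ)), star_u_mul_u, one_mul, sub_self, asympNorm_zero]

theorem one_sub_mul_star_v_mem : 1 - v θ * star (v θ) ∈ nullIdeal θ := by
  rw [mem_nullIdeal, ← asympNorm_mul_uv, uv_eq_smul, mul_smul_comm, sub_mul, one_mul,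
    mul_assoc (v θ), ← mul_assoc (star (v θ)), star_v_mul_v, one_mul, sub_self, smul_zero,
    asympNorm_zero]

theorem one_sub_mul_star_mul_mem {I : TwoSidedIdeal (FreeTwist θ)} {a b : FreeTwist θ}
    (ha : 1 - a * star a ∈ I) (hb : 1 - b * star b ∈ I) : 1 - a * b * star (a * b) ∈ I := by
  have h : 1 - a * b * star (a * b) = (1 - a * star a) + a * ((1 - b * star b) * star a) := by
    rw [star_mul]
    noncomm_ring
  rw [h]
  exact I.add_mem ha (I.mul_mem_left _ _ (I.mul_mem_right _ _ hb))

theorem one_sub_pow_mul_star_mem {I : TwoSidedIdeal (FreeTwist θ)} {a : FreeTwist θ}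
    (ha : 1 - a * star a ∈ I) (n : ℕ) : 1 - a ^ n * star (a ^ n) ∈ I := by
  induction n with
  | zero => simp [I.zero_mem]
  | succ n ih =>
    rw [pow_succ]
    exact one_sub_mul_star_mul_mem ih ha

/-- The elements `x(1 - wⁿwⁿ*)` with `w = uv` lie in `I` and differ from `x` by at most `‖x wⁿ‖`,
which tends to zero. -/
theorem mem_of_asympNorm_eq_zero {I : TwoSidedIdeal (FreeTwist θ)}
    (hI : IsClosed (I : Set (FreeTwist θ)))
    (hu : 1 - u θ * star (u θ) ∈ I) (hv : 1 - v θ * star (v θ) ∈ I) {x : FreeTwist θ}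
    (hx : asympNorm x = 0) : x ∈ I := by
  have hwn (n : ℕ) : 1 - uv θ ^ n * star (uv θ ^ n) ∈ I :=
    one_sub_pow_mul_star_mem (one_sub_mul_star_mul_mem hu hv) n
  have ht : Tendsto (fun n : ℕ => x * (1 - uv θ ^ n * star (uv θ ^ n))) atTop (𝓝 x) := by
    rw [tendsto_iff_norm_sub_tendsto_zero]
    refine squeeze_zero (fun _ => norm_nonneg _) (fun n => ?_) (hx ▸ tendsto_asympNorm x)
    rw [mul_sub, mul_one, sub_sub_cancel_left, norm_neg, ← mul_assoc]
    refine (norm_mul_le _ _).trans ?_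
    rw [norm_star_isometry (star_uv_pow_mul_uv_pow θ n), mul_one]
  exact hI.mem_of_tendsto ht (Eventually.of_forall fun n => I.mul_mem_left _ _ (hwn n))

theorem defectIdeal_eq_nullIdeal : defectIdeal θ = nullIdeal θ := by
  refine le_antisymm (sInf_le ⟨isClosed_nullIdeal, ?_⟩) (le_sInf ?_)
  · rintro _ (rfl | rfl)
    · exact one_sub_mul_star_u_mem
    · exact one_sub_mul_star_v_mem
  · rintro I ⟨hI, hs⟩ x hx
    exact mem_of_asympNorm_eq_zero hI (hs (by simp)) (hs (by simp)) (mem_nullIdeal.mp hx)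

theorem nullIdeal_ne_top : nullIdeal θ ≠ ⊤ := by
  rw [Ne, ← TwoSidedIdeal.one_mem_iff, mem_nullIdeal, asympNorm_one]
  exact one_ne_zero

/-! ### Compressions and positivity for the asymptotic norm -/

theorem asympNorm_star_mul {a : FreeTwist θ} (ha : star a * a = 1)
    (ha' : 1 - a * star a ∈ nullIdeal θ) (x : FreeTwist θ) :
    asympNorm (star a * x) = asympNorm x := by
  refine le_antisymm ?_ ?_
  · simpa [norm_star_isometry ha] using asympNorm_mul_le (star a) x
  · have h : asympNorm (x - a * (star a * x)) = 0 := by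
      rw [← mem_nullIdeal, ← mul_assoc, ← one_sub_mul]
      exact (nullIdeal θ).mul_mem_right _ _ ha'
    rw [asympNorm_eq_of_sub h]
    simpa [norm_eq_one_of_isometry ha] using asympNorm_mul_le a (star a * x)

/-- Together with `norm_compression_le` this squeezes the norms of the two-sided compressions, so
they also converge to `asympNorm x`. Unlike `x(uv)ⁿ`, these compressions preserve positivity. -/
theorem asympNorm_le_norm_compression (x : FreeTwist θ) (n : ℕ) :
    asympNorm x ≤ ‖star (uv θ ^ n) * (x * uv θ ^ n)‖ := by
  rw [← asympNorm_mul_uv_pow x n, ← asympNorm_star_mul (star_uv_pow_mul_uv_pow θ n)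
    (one_sub_pow_mul_star_mem
      (one_sub_mul_star_mul_mem one_sub_mul_star_u_mem one_sub_mul_star_v_mem) n)]
  exact asympNorm_le_norm _

theorem norm_compression_le (x : FreeTwist θ) (n : ℕ) :
    ‖star (uv θ ^ n) * (x * uv θ ^ n)‖ ≤ ‖x * uv θ ^ n‖ := by
  refine (norm_mul_le _ _).trans ?_
  rw [norm_star_isometry (star_uv_pow_mul_uv_pow θ n), one_mul]

theorem asympNorm_sq_le (x : FreeTwist θ) : asympNorm x ^ 2 ≤ asympNorm (star x * x) :=
  le_asympNorm fun n => calc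
    asympNorm x ^ 2 ≤ ‖x * uv θ ^ n‖ ^ 2 :=
      pow_le_pow_left₀ (asympNorm_nonneg x) (asympNorm_le_norm_mul_pow x n) 2
    _ = ‖star (uv θ ^ n) * (star x * x * uv θ ^ n)‖ := by
      rw [sq, ← CStarRing.norm_star_mul_self, star_mul, mul_assoc, mul_assoc]
    _ ≤ _ := norm_compression_le _ n

theorem norm_sum_star_mul_self_le_of_subset {A ι : Type*} [CStarAlgebra A] {s t : Finset ι}
    (h : s ⊆ t) (f : ι → A) :
    ‖∑ i ∈ s, star (f i) * f i‖ ≤ ‖∑ i ∈ t, star (f i) * f i‖ := by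
  let _ := CStarAlgebra.spectralOrder A
  let _ := CStarAlgebra.spectralOrderedRing A
  exact CStarAlgebra.norm_le_norm_of_nonneg_of_le
    (Finset.sum_nonneg fun i _ => star_mul_self_nonneg (f i))
    (Finset.sum_le_sum_of_subset_of_nonneg h fun i _ _ => star_mul_self_nonneg (f i))

/-- Compression by `(uv)ⁿ` keeps the form `∑ f*f`, so monotonicity of the norm on positive elements
passes to the limit. -/
theorem asympNorm_sum_star_mul_self_le_of_subset {ι : Type*} {s t : Finset ι}
    (h : s ⊆ t) (f : ι → FreeTwist θ) :
    asympNorm (∑ i ∈ s, star (f i) * f i) ≤ asympNorm (∑ i ∈ t, star (f i) * f i) := by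
  have hc (r : Finset ι) (n : ℕ) : star (uv θ ^ n) * ((∑ i ∈ r, star (f i) * f i) * uv θ ^ n) =
      ∑ i ∈ r, star (f i * uv θ ^ n) * (f i * uv θ ^ n) := by
    simp only [Finset.sum_mul, Finset.mul_sum, star_mul, mul_assoc]
  refine le_asympNorm fun n => (asympNorm_le_norm_compression _ n).trans
    (le_trans ?_ (norm_compression_le _ n))
  rw [hc, hc]
  exact norm_sum_star_mul_self_le_of_subset h _

/-! ### Groups with two elements that commute up to a central element -/

section Group

variable {G : Type*} [Group G] {a b c : G}

theorem zpow_mul_zpow_of_mul_eq (hc : ∀ x : G, Commute c x) (h : a * b = c * (b * a)) (m n : ℤ) :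
    a ^ m * b ^ n = c ^ (m * n) * (b ^ n * a ^ m) := by
  have h1 : SemiconjBy b (c * a) a := by
    rw [SemiconjBy, h, ← mul_assoc, ← mul_assoc, (hc b).eq]
  have h2 : SemiconjBy (a ^ m) b (c ^ m * b) := by
    have h3 := (h1.zpow_right m).eq
    rw [(hc a).mul_zpow, ← mul_assoc, ← ((hc b).zpow_left m).eq] at h3
    exact h3.symm
  have h4 := (h2.zpow_right n).eq
  rwa [((hc b).zpow_left m).mul_zpow, ← zpow_mul, mul_assoc] at h4

theorem zpow_mul_zpow_of_mul_eq' (hc : ∀ x : G, Commute c x) (h : a * b = c * (b * a)) (m n : ℤ) :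
    b ^ n * a ^ m = c ^ (-(m * n)) * (a ^ m * b ^ n) := by
  rw [zpow_mul_zpow_of_mul_eq hc h, ← mul_assoc, ← zpow_add, neg_add_cancel, zpow_zero, one_mul]

/-- The normal form of an element of the subgroup generated by two elements that commute up to a
central element. -/
def IsNormalForm (a b c x : G) (p q : ℤ) : Prop := ∃ k : ℤ, x = c ^ k * (a ^ p * b ^ q)

theorem IsNormalForm.left_mul (hc : ∀ x : G, Commute c x) {x : G} {p q : ℤ}
    (hx : IsNormalForm a b c x p q) (m : ℤ) : IsNormalForm a b c (a ^ m * x) (m + p) q := by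
  obtain ⟨k, rfl⟩ := hx
  exact ⟨k, by rw [zpow_add, ← mul_assoc, ← ((hc _).zpow_left k).eq, mul_assoc, mul_assoc]⟩

theorem IsNormalForm.right_mul (hc : ∀ x : G, Commute c x) (h : a * b = c * (b * a)) {x : G}
    {p q : ℤ} (hx : IsNormalForm a b c x p q) (n : ℤ) :
    IsNormalForm a b c (b ^ n * x) p (n + q) := by
  obtain ⟨k, rfl⟩ := hx
  refine ⟨k + -(p * n), ?_⟩
  rw [zpow_add b, ← mul_assoc, ← ((hc _).zpow_left k).eq, mul_assoc, ← mul_assoc (b ^ n),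
    zpow_mul_zpow_of_mul_eq' hc h, zpow_add, mul_assoc, mul_assoc, mul_assoc]

/-- In comparing `x aᵐbⁿ` with `aᵐbⁿ x`, exchanging `b^q` with `aᵐ` contributes `c^(-mq)` and
exchanging `aᵖ` with `bⁿ` contributes `c^(pn)`. -/
theorem IsNormalForm.conj_eq (hc : ∀ x : G, Commute c x) (h : a * b = c * (b * a)) {x : G}
    {p q : ℤ} (hx : IsNormalForm a b c x p q) (m n : ℤ) :
    (a ^ m * b ^ n)⁻¹ * x * (a ^ m * b ^ n) = c ^ (n * p - m * q) * x := by
  obtain ⟨k, rfl⟩ := hx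
  rw [mul_assoc, inv_mul_eq_iff_eq_mul]
  have hk (j : ℤ) (y : G) : y * c ^ j = c ^ j * y := (((hc y).zpow_left j).eq).symm
  calc c ^ k * (a ^ p * b ^ q) * (a ^ m * b ^ n)
      = c ^ k * (a ^ p * (b ^ q * a ^ m) * b ^ n) := by group
    _ = c ^ k * (c ^ (-(m * q)) * (a ^ p * a ^ m * b ^ (q + n))) := by
        rw [zpow_mul_zpow_of_mul_eq' hc h, ← mul_assoc (a ^ p), hk]
        group
    _ = c ^ k * (c ^ (-(m * q)) * (a ^ m * (a ^ p * b ^ n) * b ^ q)) := by group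
    _ = c ^ k * (c ^ (-(m * q)) * (c ^ (p * n) * (a ^ m * b ^ n * (a ^ p * b ^ q)))) := by
        rw [zpow_mul_zpow_of_mul_eq hc h p n, ← mul_assoc (a ^ m), hk]
        group
    _ = c ^ (n * p - m * q) * (c ^ k * (a ^ m * b ^ n * (a ^ p * b ^ q))) := by
        generalize a ^ m * b ^ n * (a ^ p * b ^ q) = y
        rw [← mul_assoc, ← zpow_add, ← mul_assoc, ← zpow_add, ← mul_assoc, ← zpow_add]
        congr 2
        ring
    _ = a ^ m * b ^ n * (c ^ (n * p - m * q) * (c ^ k * (a ^ p * b ^ q))) := by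
        generalize a ^ m * b ^ n = g
        generalize a ^ p * b ^ q = y
        rw [← mul_assoc g, hk, mul_assoc, ← mul_assoc g (c ^ k), hk, mul_assoc]

end Group

/-! ### Compressions by the words `uᵐvⁿ` -/

/-- The isometry `uᵐvⁿ`. -/
def word (θ : ℝ) (i : ℕ × ℕ) : FreeTwist θ := u θ ^ i.1 * v θ ^ i.2

/-- The compression `x ↦ (uᵐvⁿ)* x uᵐvⁿ`. -/
def conjWord (θ : ℝ) (i : ℕ × ℕ) : FreeTwist θ →ₗ[ℂ] FreeTwist θ :=
  LinearMap.mulLeft ℂ (star (word θ i)) ∘ₗ LinearMap.mulRight ℂ (word θ i)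

theorem conjWord_apply (i : ℕ × ℕ) (x : FreeTwist θ) :
    conjWord θ i x = star (word θ i) * (x * word θ i) := rfl

theorem star_word_mul_word (i : ℕ × ℕ) : star (word θ i) * word θ i = 1 := by
  rw [word, star_mul, mul_assoc, ← mul_assoc (star _) (u θ ^ _),
    star_pow_mul_pow (star_u_mul_u θ), one_mul, star_pow_mul_pow (star_v_mul_v θ)]

theorem one_sub_word_mul_star_mem (i : ℕ × ℕ) :
    1 - word θ i * star (word θ i) ∈ nullIdeal θ :=
  one_sub_mul_star_mul_mem (one_sub_pow_mul_star_mem one_sub_mul_star_u_mem _)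
    (one_sub_pow_mul_star_mem one_sub_mul_star_v_mem _)

theorem asympNorm_mul_word (x : FreeTwist θ) (i : ℕ × ℕ) :
    asympNorm (x * word θ i) = asympNorm x := by
  have hu (y : FreeTwist θ) (n : ℕ) : asympNorm (y * u θ ^ n) = asympNorm y := by
    induction n with
    | zero => simp
    | succ n ih => rw [pow_succ, ← mul_assoc, asympNorm_mul_u, ih]
  have hv (y : FreeTwist θ) (n : ℕ) : asympNorm (y * v θ ^ n) = asympNorm y := by
    induction n with
    | zero => simp
    | succ n ih => rw [pow_succ, ← mul_assoc, asympNorm_mul_v, ih]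
  rw [word, ← mul_assoc, hv, hu]

theorem asympNorm_conjWord (i : ℕ × ℕ) (x : FreeTwist θ) :
    asympNorm (conjWord θ i x) = asympNorm x := by
  rw [conjWord_apply, asympNorm_star_mul (star_word_mul_word i) (one_sub_word_mul_star_mem i),
    asympNorm_mul_word]

/-! ### Monomials modulo the null ideal -/

section Quotient

/-- The projection onto the quotient by the null ideal. -/
def nullProj (θ : ℝ) : FreeTwist θ →+* (nullIdeal θ).ringCon.Quotient := (nullIdeal θ).ringCon.mk'

/-- The quotient serves only as a ring in which `u` and `v` are invertible, so that the group
identities apply. This equivalence carries them back to estimates in the free twist. -/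
theorem nullProj_eq_iff {x y : FreeTwist θ} : nullProj θ x = nullProj θ y ↔ asympNorm (x - y) = 0 :=
  ((nullIdeal θ).ringCon.eq).trans (((nullIdeal θ).rel_iff x y).trans mem_nullIdeal)

/-- The class of an isometry whose range projection is trivial modulo the null ideal. -/
def nullUnit (a : FreeTwist θ) (ha : star a * a = 1) (ha' : 1 - a * star a ∈ nullIdeal θ) :
    (nullIdeal θ).ringCon.Quotientˣ where
  val := nullProj θ a
  inv := nullProj θ (star a)
  val_inv := by
    rw [← map_mul, ← map_one (nullProj θ), eq_comm, nullProj_eq_iff, ← mem_nullIdeal]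
    exact ha'
  inv_val := by rw [← map_mul, ha, map_one]

/-- The class of `u`. -/
def uUnit (θ : ℝ) : (nullIdeal θ).ringCon.Quotientˣ :=
  nullUnit (u θ) (star_u_mul_u θ) one_sub_mul_star_u_mem

/-- The class of `v`. -/
def vUnit (θ : ℝ) : (nullIdeal θ).ringCon.Quotientˣ :=
  nullUnit (v θ) (star_v_mul_v θ) one_sub_mul_star_v_mem

/-- The class of the twist. -/
def twistUnit (θ : ℝ) : (nullIdeal θ).ringCon.Quotientˣ :=
  Units.map ((nullProj θ).comp (algebraMap ℂ (FreeTwist θ))).toMonoidHom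
    (Units.mk0 (twist θ) (twist_ne_zero θ))

theorem val_twistUnit_zpow (k : ℤ) :
    ((twistUnit θ ^ k : (nullIdeal θ).ringCon.Quotientˣ) : (nullIdeal θ).ringCon.Quotient) =
      nullProj θ (algebraMap ℂ _ (twist θ ^ k)) := by
  rw [twistUnit, ← map_zpow, Units.coe_map, Units.val_zpow_eq_zpow_val]
  rfl

theorem nullProj_surjective : Function.Surjective (nullProj θ) :=
  (nullIdeal θ).ringCon.mk'_surjective

theorem twistUnit_commute (x : (nullIdeal θ).ringCon.Quotientˣ) : Commute (twistUnit θ) x := by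
  obtain ⟨y, hy⟩ := nullProj_surjective (x : (nullIdeal θ).ringCon.Quotient)
  refine Units.ext ?_
  rw [Units.val_mul, Units.val_mul, ← hy, ← zpow_one (twistUnit θ), val_twistUnit_zpow, ← map_mul,
    ← map_mul, Algebra.commutes]

theorem uUnit_mul_vUnit : uUnit θ * vUnit θ = twistUnit θ * (vUnit θ * uUnit θ) := by
  refine Units.ext ?_
  rw [Units.val_mul, Units.val_mul, Units.val_mul, ← zpow_one (twistUnit θ), val_twistUnit_zpow,
    zpow_one]
  change nullProj θ (u θ) * nullProj θ (v θ) = _ * (nullProj θ (v θ) * nullProj θ (u θ))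
  rw [← map_mul, ← map_mul, ← map_mul, u_mul_v, Algebra.smul_def]

/-- Formal adjoints become inverses, so prepending a letter multiplies on the left by `u` or `v` to
the power `1` or `-1`, which keeps the normal form. -/
theorem exists_isNormalForm (m : FreeMonoid Gen) :
    ∃ (x : (nullIdeal θ).ringCon.Quotientˣ) (p q : ℤ), (x : (nullIdeal θ).ringCon.Quotient) =
      nullProj θ (ofPoly (mono m)) ∧ IsNormalForm (uUnit θ) (vUnit θ) (twistUnit θ) x p q := by
  induction m using FreeMonoid.inductionOn' with
  | one => exact ⟨1, 0, 0, by simp, 0, by simp⟩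
  | of_mul g m ih =>
    obtain ⟨x, p, q, hx, hn⟩ := ih
    have hl : ∀ y : (nullIdeal θ).ringCon.Quotientˣ,
        (y : (nullIdeal θ).ringCon.Quotient) = nullProj θ (ofPoly (letter g)) →
        ((y * x : (nullIdeal θ).ringCon.Quotientˣ) : (nullIdeal θ).ringCon.Quotient) =
          nullProj θ (ofPoly (mono (FreeMonoid.of g * m))) := by
      intro y hy
      rw [Units.val_mul, hy, hx, map_mul, map_mul, map_mul]
      rfl
    have hleft := hn.left_mul twistUnit_commute
    have hright := hn.right_mul twistUnit_commute uUnit_mul_vUnit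
    cases g with
    | u => exact ⟨_, _, _, hl (uUnit θ ^ (1 : ℤ)) (by rw [zpow_one]; rfl), hleft 1⟩
    | v => exact ⟨_, _, _, hl (vUnit θ ^ (1 : ℤ)) (by rw [zpow_one]; rfl), hright 1⟩
    | uStar =>
      refine ⟨_, _, _, hl (uUnit θ ^ (-1 : ℤ)) ?_, hleft (-1)⟩
      rw [zpow_neg_one]
      change nullProj θ (star (u θ)) = _
      rw [u, star_ofPoly, star_letter]
      rfl
    | vStar =>
      refine ⟨_, _, _, hl (vUnit θ ^ (-1 : ℤ)) ?_, hright (-1)⟩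
      rw [zpow_neg_one]
      change nullProj θ (star (v θ)) = _
      rw [v, star_ofPoly, star_letter]
      rfl

/-- Modulo the null ideal, a monomial is an eigenvector of all compressions, and it is a scalar if
the exponents that describe the eigenvalues vanish. -/
theorem exists_conjWord_mono (m : FreeMonoid Gen) : ∃ p q : ℤ,
    (∀ i, asympNorm (conjWord θ i (ofPoly (mono m)) -
      twist θ ^ (i.2 * p - i.1 * q : ℤ) • ofPoly (mono m)) = 0) ∧
    (p = 0 → q = 0 → ∃ c : ℂ, asympNorm (ofPoly (mono m) - c • (1 : FreeTwist θ)) = 0) := by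
  obtain ⟨x, p, q, hx, hn⟩ := exists_isNormalForm (θ := θ) m
  refine ⟨p, q, fun i => ?_, ?_⟩
  · have h := congrArg Units.val
      (hn.conj_eq twistUnit_commute uUnit_mul_vUnit (i.1 : ℤ) (i.2 : ℤ))
    -- The conjugating unit is the class of `word θ i`, and its inverse is by construction the class
    -- of the adjoint; group conjugation thus becomes the compression.
    have hg : uUnit θ ^ (i.1 : ℤ) * vUnit θ ^ (i.2 : ℤ) =
        nullUnit (word θ i) (star_word_mul_word i) (one_sub_word_mul_star_mem i) := by
      refine Units.ext ?_
      rw [zpow_natCast, zpow_natCast, Units.val_mul, Units.val_pow_eq_pow_val,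
        Units.val_pow_eq_pow_val]
      change nullProj θ (u θ) ^ i.1 * nullProj θ (v θ) ^ i.2 = nullProj θ (word θ i)
      rw [word, map_mul, map_pow, map_pow]
    rw [hg, Units.val_mul, Units.val_mul, Units.val_mul, hx, val_twistUnit_zpow, ← map_mul,
      ← Algebra.smul_def] at h
    rw [← nullProj_eq_iff, ← h, conjWord_apply, ← mul_assoc, map_mul, map_mul]
    rfl
  · rintro rfl rfl
    obtain ⟨k, hk⟩ := hn
    refine ⟨twist θ ^ k, ?_⟩
    rw [← nullProj_eq_iff, ← hx, hk, zpow_zero, zpow_zero, mul_one, mul_one, val_twistUnit_zpow,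
      Algebra.algebraMap_eq_smul_one]

end Quotient

/-! ### Averages converge to scalars -/

section Average

/-- The average of the compressions by `uᵐvⁿ` for `m, n < N`. -/
def wordAverage (θ : ℝ) (N : ℕ) : FreeTwist θ →ₗ[ℂ] FreeTwist θ :=
  ((N : ℂ) ^ 2)⁻¹ • ∑ i ∈ Finset.range N ×ˢ Finset.range N, conjWord θ i

theorem wordAverage_apply (N : ℕ) (x : FreeTwist θ) : wordAverage θ N x =
    ((N : ℂ) ^ 2)⁻¹ • ∑ i ∈ Finset.range N ×ˢ Finset.range N, conjWord θ i x := by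
  simp [wordAverage]

/-- Used twice: with the eigenvalues `s` and a monomial `y` it reduces averages to scalar sums, and
with `s = 0` it shows that averaging is contractive. -/
theorem asympNorm_wordAverage_sub_le (N : ℕ) (x : FreeTwist θ) {s : ℕ × ℕ → ℂ} {y : FreeTwist θ}
    {ε : ℝ} (hε : 0 ≤ ε) (h : ∀ i, asympNorm (conjWord θ i x - s i • y) ≤ ε) :
    asympNorm (wordAverage θ N x -
      (((N : ℂ) ^ 2)⁻¹ * ∑ i ∈ Finset.range N ×ˢ Finset.range N, s i) • y) ≤ ε := by
  rw [wordAverage_apply, mul_smul, Finset.sum_smul, ← smul_sub, ← Finset.sum_sub_distrib,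
    asympNorm_smul, norm_inv, norm_pow, Complex.norm_natCast]
  have hsum := (asympNorm_sum_le (Finset.range N ×ˢ Finset.range N)
    fun i => conjWord θ i x - s i • y).trans (Finset.sum_le_card_nsmul _ _ ε fun i _ => h i)
  rw [Finset.card_product, Finset.card_range, nsmul_eq_mul, Nat.cast_mul, ← sq] at hsum
  -- For `N = 0` the sum is empty and the left side is zero.
  rcases N.eq_zero_or_pos with rfl | hN
  · simpa using hε
  · rwa [inv_mul_le_iff₀ (by positivity)]

theorem asympNorm_wordAverage_le (N : ℕ) (x : FreeTwist θ) :
    asympNorm (wordAverage θ N x) ≤ asympNorm x := by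
  simpa using asympNorm_wordAverage_sub_le N x (s := fun _ => 0) (y := 0) (asympNorm_nonneg x)
    fun i => by simp [asympNorm_conjWord]

theorem norm_sum_pow_le {z : ℂ} (hz : ‖z‖ = 1) (hz1 : z ≠ 1) (N : ℕ) :
    ‖∑ a ∈ Finset.range N, z ^ a‖ ≤ 2 / ‖z - 1‖ := by
  rw [geom_sum_eq hz1, norm_div]
  gcongr
  calc ‖z ^ N - 1‖ ≤ ‖z ^ N‖ + ‖(1 : ℂ)‖ := norm_sub_le _ _
    _ = 2 := by rw [norm_pow, hz, one_pow, norm_one]; norm_num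

theorem norm_sum_pow_le_card {z : ℂ} (hz : ‖z‖ = 1) (N : ℕ) :
    ‖∑ a ∈ Finset.range N, z ^ a‖ ≤ N := by
  simpa [hz] using norm_sum_le (Finset.range N) fun a => z ^ a

/-- The geometric sum with ratio different from 1 is bounded uniformly in `N`; the other is at most
`N`. -/
theorem exists_norm_sum_mul_sum_le {z w : ℂ} (hz : ‖z‖ = 1) (hw : ‖w‖ = 1)
    (h : z ≠ 1 ∨ w ≠ 1) : ∃ C : ℝ, ∀ N : ℕ,
    ‖(∑ a ∈ Finset.range N, z ^ a) * ∑ b ∈ Finset.range N, w ^ b‖ ≤ C * N := by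
  rcases h with h | h
  · refine ⟨2 / ‖z - 1‖, fun N => ?_⟩
    rw [norm_mul]
    exact mul_le_mul (norm_sum_pow_le hz h N) (norm_sum_pow_le_card hw N) (norm_nonneg _)
      (by positivity)
  · refine ⟨2 / ‖w - 1‖, fun N => ?_⟩
    rw [norm_mul, mul_comm]
    exact mul_le_mul (norm_sum_pow_le hw h N) (norm_sum_pow_le_card hz N) (norm_nonneg _)
      (by positivity)

/-- This is where irrationality enters the argument. -/
theorem twist_zpow_ne_one (hθ : Irrational θ) {k : ℤ} (hk : k ≠ 0) : twist θ ^ k ≠ 1 := by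
  rw [twist, ← Complex.exp_int_mul, Ne, Complex.exp_eq_one_iff]
  rintro ⟨n, hn⟩
  have h2 : (2 * Real.pi * Complex.I : ℂ) ≠ 0 := Complex.two_pi_I_ne_zero
  have h : (k * θ : ℂ) = n := by
    refine mul_right_cancel₀ h2 ?_
    rw [← hn]
    ring
  have h' : (k * θ : ℝ) = n := by exact_mod_cast h
  exact (hθ.intCast_mul hk).ne_int n h'

theorem exists_eventually_wordAverage_mono (hθ : Irrational θ) (m : FreeMonoid Gen) {ε : ℝ}
    (hε : 0 < ε) : ∃ t : ℂ, ∀ᶠ N in atTop,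
    asympNorm (wordAverage θ N (ofPoly (mono m)) - t • (1 : FreeTwist θ)) ≤ ε := by
  obtain ⟨p, q, heig, hscal⟩ := exists_conjWord_mono (θ := θ) m
  have havg (N : ℕ) := asympNorm_wordAverage_sub_le N (ofPoly (mono m)) le_rfl
    fun i => (heig i).le
  by_cases hpq : p = 0 ∧ q = 0
  · obtain ⟨c, hc⟩ := hscal hpq.1 hpq.2
    refine ⟨c, (eventually_ge_atTop 1).mono fun N hN => ?_⟩
    have hN0 : (N : ℂ) ≠ 0 := by exact_mod_cast Nat.one_le_iff_ne_zero.mp hN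
    have h1 := havg N
    simp only [hpq.1, hpq.2, mul_zero, sub_zero, zpow_zero, Finset.sum_const, Finset.card_product,
      Finset.card_range, nsmul_eq_mul, mul_one, ← sq, Nat.cast_pow,
      inv_mul_cancel₀ (pow_ne_zero 2 hN0), one_smul] at h1
    have h2 := asympNorm_add_le (wordAverage θ N (ofPoly (mono m)) - ofPoly (mono m))
      (ofPoly (mono m) - c • (1 : FreeTwist θ))
    rw [sub_add_sub_cancel, hc] at h2
    linarith
  · have hz (k : ℤ) : ‖twist θ ^ k‖ = 1 := by rw [norm_zpow, norm_twist, one_zpow]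
    obtain ⟨C, hC⟩ := exists_norm_sum_mul_sum_le (hz (-q)) (hz p) (by
      rcases not_and_or.mp hpq with h | h
      · exact .inr (twist_zpow_ne_one hθ h)
      · exact .inl (twist_zpow_ne_one hθ (neg_ne_zero.mpr h)))
    -- The eigenvalue sum splits into geometric sums with ratios `λ^(-q)` and `λ^p`, not both 1. It
    -- is therefore `O(N)`, and dividing by `N²` leaves `C / N`.
    refine ⟨0, ?_⟩
    filter_upwards [(tendsto_const_div_atTop_nhds_zero_nat C).eventually_le_const hε,
      eventually_ge_atTop 1] with N hN hN1
    have hN0 : (0 : ℝ) < N := by exact_mod_cast hN1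
    have hsum : ∑ i ∈ Finset.range N ×ˢ Finset.range N, twist θ ^ (i.2 * p - i.1 * q : ℤ) =
        (∑ a ∈ Finset.range N, (twist θ ^ (-q)) ^ a) *
          ∑ b ∈ Finset.range N, (twist θ ^ p) ^ b := by
      rw [Finset.sum_mul_sum, Finset.sum_product]
      refine Finset.sum_congr rfl fun a _ => Finset.sum_congr rfl fun b _ => ?_
      rw [← zpow_natCast, ← zpow_natCast, ← zpow_mul, ← zpow_mul,
        ← zpow_add₀ (twist_ne_zero θ)]
      congr 1
      ring
    have h1 := asympNorm_le_add (wordAverage θ N (ofPoly (mono m)))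
      ((((N : ℂ) ^ 2)⁻¹ * ∑ i ∈ Finset.range N ×ˢ Finset.range N,
        twist θ ^ (i.2 * p - i.1 * q : ℤ)) • ofPoly (mono m))
    have h2 : ‖((N : ℂ) ^ 2)⁻¹ * ∑ i ∈ Finset.range N ×ˢ Finset.range N,
        twist θ ^ (i.2 * p - i.1 * q : ℤ)‖ ≤ C / N := by
      rw [hsum, norm_mul, norm_inv, norm_pow, Complex.norm_natCast, inv_mul_le_iff₀ (by positivity)]
      refine (hC N).trans_eq ?_
      field_simp
    rw [asympNorm_smul] at h1
    have h3 : asympNorm (ofPoly (mono m : Poly θ)) ≤ 1 :=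
      (asympNorm_le_norm _).trans (norm_ofPoly_mono_le m)
    rw [zero_smul, sub_zero]
    have h4 := mul_le_mul h2 h3 (asympNorm_nonneg _) ((norm_nonneg _).trans h2)
    have h5 := havg N
    linarith

/-- The averages of every element approach the scalars. -/
theorem exists_eventually_wordAverage (hθ : Irrational θ) (x : FreeTwist θ) {ε : ℝ} (hε : 0 < ε) :
    ∃ t : ℂ, ∀ᶠ N in atTop, asympNorm (wordAverage θ N x - t • (1 : FreeTwist θ)) ≤ ε := by
  have hpoly (y : Poly θ) : ∀ ε > (0 : ℝ), ∃ t : ℂ, ∀ᶠ N in atTop,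
      asympNorm (wordAverage θ N (ofPoly y) - t • (1 : FreeTwist θ)) ≤ ε := by
    induction y using poly_induction with
    | mono m => exact fun ε hε => exists_eventually_wordAverage_mono hθ m hε
    | add y z hy hz =>
      intro ε hε
      obtain ⟨s, hs⟩ := hy (ε / 2) (half_pos hε)
      obtain ⟨t, ht⟩ := hz (ε / 2) (half_pos hε)
      refine ⟨s + t, ?_⟩
      filter_upwards [hs, ht] with N h1 h2
      rw [map_add, map_add, add_smul, add_sub_add_comm]
      linarith [asympNorm_add_le (wordAverage θ N (ofPoly y) - s • (1 : FreeTwist θ))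
        (wordAverage θ N (ofPoly z) - t • (1 : FreeTwist θ))]
    | smul c y hy =>
      intro ε hε
      -- The added 1 covers `c = 0`.
      obtain ⟨t, ht⟩ := hy (ε / (‖c‖ + 1)) (by positivity)
      refine ⟨c * t, ht.mono fun N h => ?_⟩
      rw [map_smul, map_smul, mul_smul, ← smul_sub, asympNorm_smul]
      rw [le_div_iff₀ (by positivity)] at h
      nlinarith [asympNorm_nonneg (wordAverage θ N (ofPoly y) - t • (1 : FreeTwist θ)),
        norm_nonneg c]
  -- Polynomials are dense and averaging is contractive, so half of `ε` pays for the approximation.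
  obtain ⟨_, ⟨y, rfl⟩, hy⟩ := Metric.mem_closure_iff.mp (denseRange_ofPoly x) (ε / 2) (half_pos hε)
  obtain ⟨t, ht⟩ := hpoly y (ε / 2) (half_pos hε)
  refine ⟨t, ht.mono fun N h => ?_⟩
  have h1 := asympNorm_add_le (wordAverage θ N (x - ofPoly y))
    (wordAverage θ N (ofPoly y) - t • (1 : FreeTwist θ))
  rw [map_sub, sub_add_sub_cancel, ← map_sub] at h1
  have h2 := (asympNorm_wordAverage_le N (x - ofPoly y)).trans (asympNorm_le_norm _)
  rw [dist_eq_norm] at hy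
  linarith

end Average

/-! ### Total boundedness of orbits and the lower bound for averages -/

section Orbit

/-- The orbits under the compressions are totally bounded for the asymptotic norm. -/
theorem exists_finite_orbit_cover (x : FreeTwist θ) {ε : ℝ} (hε : 0 < ε) :
    ∃ F : Set (FreeTwist θ), F.Finite ∧ ∀ i, ∃ f ∈ F, asympNorm (conjWord θ i x - f) ≤ ε := by
  have hpoly (y : Poly θ) : ∀ ε > (0 : ℝ), ∃ F : Set (FreeTwist θ), F.Finite ∧
      ∀ i, ∃ f ∈ F, asympNorm (conjWord θ i (ofPoly y) - f) ≤ ε := by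
    induction y using poly_induction with
    | mono m =>
      intro ε hε
      obtain ⟨p, q, heig, -⟩ := exists_conjWord_mono (θ := θ) m
      -- Modulo null elements, the orbit of a monomial consists of its multiples by scalars in the
      -- compact unit circle.
      obtain ⟨T, hT, hcover⟩ := Metric.totallyBounded_iff.mp
        (isCompact_sphere (0 : ℂ) 1).totallyBounded ε hε
      refine ⟨(fun t : ℂ => t • ofPoly (mono m)) '' T, hT.image _, fun i => ?_⟩
      have hmem : twist θ ^ (i.2 * p - i.1 * q : ℤ) ∈ Metric.sphere (0 : ℂ) 1 := by
        rw [mem_sphere_zero_iff_norm, norm_zpow, norm_twist, one_zpow]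
      obtain ⟨t, ht, hdist⟩ := Set.mem_iUnion₂.mp (hcover hmem)
      refine ⟨_, ⟨t, ht, rfl⟩, ?_⟩
      have h1 := asympNorm_add_le (conjWord θ i (ofPoly (mono m)) -
        twist θ ^ (i.2 * p - i.1 * q : ℤ) • ofPoly (mono m))
        (twist θ ^ (i.2 * p - i.1 * q : ℤ) • ofPoly (mono m) - t • ofPoly (mono m))
      rw [sub_add_sub_cancel, heig, zero_add, ← sub_smul, asympNorm_smul] at h1
      have h3 : asympNorm (ofPoly (mono m : Poly θ)) ≤ 1 :=
        (asympNorm_le_norm _).trans (norm_ofPoly_mono_le m)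
      rw [Metric.mem_ball, dist_eq_norm] at hdist
      exact h1.trans ((mul_le_of_le_one_right (norm_nonneg _) h3).trans hdist.le)
    | add y z hy hz =>
      intro ε hε
      obtain ⟨F, hF, hy⟩ := hy (ε / 2) (half_pos hε)
      obtain ⟨G, hG, hz⟩ := hz (ε / 2) (half_pos hε)
      refine ⟨Set.image2 (· + ·) F G, hF.image2 _ hG, fun i => ?_⟩
      obtain ⟨f, hf, h1⟩ := hy i
      obtain ⟨g, hg, h2⟩ := hz i
      refine ⟨f + g, ⟨f, hf, g, hg, rfl⟩, ?_⟩
      rw [map_add, map_add, add_sub_add_comm]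
      linarith [asympNorm_add_le (conjWord θ i (ofPoly y) - f) (conjWord θ i (ofPoly z) - g)]
    | smul c y hy =>
      intro ε hε
      obtain ⟨F, hF, hy⟩ := hy (ε / (‖c‖ + 1)) (by positivity)
      refine ⟨(fun f => c • f) '' F, hF.image _, fun i => ?_⟩
      obtain ⟨f, hf, h⟩ := hy i
      refine ⟨_, ⟨f, hf, rfl⟩, ?_⟩
      rw [map_smul, map_smul, ← smul_sub, asympNorm_smul]
      rw [le_div_iff₀ (by positivity)] at h
      nlinarith [asympNorm_nonneg (conjWord θ i (ofPoly y) - f), norm_nonneg c]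
  obtain ⟨_, ⟨y, rfl⟩, hy⟩ := Metric.mem_closure_iff.mp (denseRange_ofPoly x) (ε / 2) (half_pos hε)
  obtain ⟨F, hF, h⟩ := hpoly y (ε / 2) (half_pos hε)
  refine ⟨F, hF, fun i => ?_⟩
  obtain ⟨f, hf, h⟩ := h i
  refine ⟨f, hf, ?_⟩
  have h1 := asympNorm_add_le (conjWord θ i (x - ofPoly y)) (conjWord θ i (ofPoly y) - f)
  rw [map_sub, sub_add_sub_cancel, ← map_sub, asympNorm_conjWord] at h1
  have h2 := asympNorm_le_norm (x - ofPoly y)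
  rw [dist_eq_norm] at hy
  linarith

theorem conjWord_star_mul_self (i : ℕ × ℕ) (x : FreeTwist θ) :
    conjWord θ i (star x * x) = star (x * word θ i) * (x * word θ i) := by
  rw [conjWord_apply, star_mul, mul_assoc, mul_assoc]

/-- The averages of a positive element that is not null are bounded below. -/
theorem exists_pos_le_asympNorm_wordAverage {x : FreeTwist θ} (hx : asympNorm x ≠ 0) :
    ∃ c > (0 : ℝ), ∀ N : ℕ, 0 < N → c ≤ asympNorm (wordAverage θ N (star x * x)) := by
  classical
  set y := star x * x with hy
  have hpos : 0 < asympNorm y :=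
    (pow_pos (lt_of_le_of_ne (asympNorm_nonneg x) hx.symm) 2).trans_le (asympNorm_sq_le x)
  -- With error a quarter of `asympNorm y`, a centre that is used has size at least three quarters;
  -- a sum of compressions near one centre then keeps at least half of `asympNorm y` per term.
  obtain ⟨F, hF, hcover⟩ := exists_finite_orbit_cover y (show 0 < asympNorm y / 4 by positivity)
  choose φ hφF hφ using hcover
  lift F to Finset (FreeTwist θ) using hF
  have hFne : F.Nonempty := ⟨φ 0, hφF 0⟩
  have hk : (0 : ℝ) < F.card := by exact_mod_cast hFne.card_pos
  refine ⟨asympNorm y / (2 * F.card), by positivity, fun N hN => ?_⟩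
  have hN' : (0 : ℝ) < N := by exact_mod_cast hN
  set T := Finset.range N ×ˢ Finset.range N with hT
  have hTcard : (T.card : ℝ) = N ^ 2 := by
    rw [hT, Finset.card_product, Finset.card_range, Nat.cast_mul, sq]
  -- Pigeonhole: some centre serves at least `N² / |F|` of the `N²` indices. As `F` does not depend
  -- on `N`, neither does the final constant.
  obtain ⟨f, hfF, hcard⟩ := Finset.exists_le_card_fiber_of_nsmul_le_card_of_maps_to
    (s := T) (t := F) (f := φ) (b := (N ^ 2 / F.card : ℝ)) (fun i _ => hφF i) hFne (by
      rw [hTcard, nsmul_eq_mul, mul_div_cancel₀ _ hk.ne'])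
  set S := T.filter fun i => φ i = f with hS
  have hSpos : (0 : ℝ) < S.card := lt_of_lt_of_le (by positivity) hcard
  have hnear : ∀ i ∈ S, asympNorm (conjWord θ i y - f) ≤ asympNorm y / 4 := fun i hi => by
    rw [← (Finset.mem_filter.mp hi).2]
    exact hφ i
  obtain ⟨i₀, hi₀⟩ := Finset.card_pos.mp (by exact_mod_cast hSpos : 0 < S.card)
  have hf : asympNorm y * (3 / 4) ≤ asympNorm f := by
    have h1 := asympNorm_le_add (conjWord θ i₀ y) f
    rw [asympNorm_conjWord] at h1
    linarith [hnear i₀ hi₀]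
  have hsumS : S.card * (asympNorm y / 2) ≤ asympNorm (∑ i ∈ S, conjWord θ i y) := by
    have h1 := (asympNorm_sum_le S fun i => f - conjWord θ i y).trans
      (Finset.sum_le_card_nsmul _ _ (asympNorm y / 4) fun i hi => by
        rw [asympNorm_sub_rev]
        exact hnear i hi)
    have h2 := asympNorm_le_add (∑ _i ∈ S, f) (∑ i ∈ S, conjWord θ i y)
    rw [← Finset.sum_sub_distrib, Finset.sum_const, ← Nat.cast_smul_eq_nsmul ℂ, asympNorm_smul,
      Complex.norm_natCast] at h2
    rw [nsmul_eq_mul] at h1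
    nlinarith
  -- The compressions of `x*x` are again of the form `f*f`, so the terms outside `S` cannot cancel
  -- those in `S`.
  have hmono : asympNorm (∑ i ∈ S, conjWord θ i y) ≤ asympNorm (∑ i ∈ T, conjWord θ i y) := by
    simp only [hy, conjWord_star_mul_self]
    exact asympNorm_sum_star_mul_self_le_of_subset (Finset.filter_subset _ _) _
  rw [wordAverage_apply, asympNorm_smul, norm_inv, norm_pow, Complex.norm_natCast,
    le_inv_mul_iff₀ (by positivity)]
  calc (N : ℝ) ^ 2 * (asympNorm y / (2 * F.card)) = N ^ 2 / F.card * (asympNorm y / 2) := by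
        field_simp
    _ ≤ S.card * (asympNorm y / 2) := by gcongr
    _ ≤ _ := hsumS.trans hmono

end Orbit

/-! ### Invertible elements in ideals outside the null ideal -/

theorem eq_top_of_asympNorm_sub_smul_lt {I : TwoSidedIdeal (FreeTwist θ)} {x : FreeTwist θ}
    (hx : x ∈ I) {t : ℂ} (h : asympNorm (x - t • (1 : FreeTwist θ)) < ‖t‖) : I = ⊤ := by
  have ht : t ≠ 0 := norm_pos_iff.mp ((asympNorm_nonneg _).trans_lt h)
  -- A strict inequality for the limit already holds at a finite stage. Compression by `(uv)ⁿ` fixes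
  -- `t • 1` and keeps `x` in `I`, so it yields a norm estimate within `I`.
  obtain ⟨n, hn⟩ := ((tendsto_asympNorm _).eventually_lt_const h).exists
  set z := star (uv θ ^ n) * (x * uv θ ^ n) with hz
  have hzI : t⁻¹ • z ∈ I := by
    rw [← one_mul z, ← smul_mul_assoc]
    exact I.mul_mem_left _ _ (I.mul_mem_left _ _ (I.mul_mem_right _ _ hx))
  have hzt : ‖z - t • (1 : FreeTwist θ)‖ < ‖t‖ := by
    have h1 : z - t • (1 : FreeTwist θ) =
        star (uv θ ^ n) * ((x - t • (1 : FreeTwist θ)) * uv θ ^ n) := by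
      rw [sub_mul, mul_sub, smul_mul_assoc, one_mul, mul_smul_comm, star_uv_pow_mul_uv_pow]
    rw [h1]
    exact (norm_compression_le _ n).trans_lt hn
  have hlt : ‖1 - t⁻¹ • z‖ < 1 := by
    have h1 : 1 - t⁻¹ • z = -(t⁻¹ • (z - t • (1 : FreeTwist θ))) := by
      rw [smul_sub, inv_smul_smul₀ ht, neg_sub]
    rw [h1, norm_neg, norm_smul, norm_inv, inv_mul_lt_iff₀ (norm_pos_iff.mpr ht), mul_one]
    exact hzt
  rw [← TwoSidedIdeal.one_mem_iff]
  have hunit := (Units.oneSub _ hlt).mul_inv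
  rw [Units.val_oneSub, sub_sub_cancel] at hunit
  rw [← hunit]
  exact I.mul_mem_right _ _ hzI

theorem le_nullIdeal (hθ : Irrational θ) {I : TwoSidedIdeal (FreeTwist θ)} (hI : I ≠ ⊤) :
    I ≤ nullIdeal θ := by
  intro x hx
  by_contra hx'
  obtain ⟨c, hc, hlower⟩ := exists_pos_le_asympNorm_wordAverage (mt mem_nullIdeal.mpr hx')
  -- The lower bound `c` forces `‖t‖ ≥ c - c/3`, which exceeds the error `c/3`.
  obtain ⟨t, ht⟩ := exists_eventually_wordAverage hθ (star x * x) (show 0 < c / 3 by positivity)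
  obtain ⟨N, hN, hNpos⟩ := (ht.and (eventually_gt_atTop 0)).exists
  have havg : wordAverage θ N (star x * x) ∈ I := by
    rw [wordAverage_apply, ← one_mul (∑ i ∈ _, _), ← smul_mul_assoc]
    refine I.mul_mem_left _ _ (sum_mem fun i _ => ?_)
    exact I.mul_mem_left _ _ (I.mul_mem_right _ _ (I.mul_mem_left _ _ hx))
  refine hI (eq_top_of_asympNorm_sub_smul_lt havg (hN.trans_lt ?_))
  have h1 := asympNorm_le_add (wordAverage θ N (star x * x)) (t • (1 : FreeTwist θ))
  rw [asympNorm_smul, asympNorm_one] at h1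
  linarith [hlower N hNpos]

end FreeTwist

end

theorem mainTheorem8 (θ : ℝ) (hθ : Irrational θ) :
    (∀ I : TwoSidedIdeal (FreeTwist θ), I ≠ ⊤ → I ≤ defectIdeal θ) ∧
      IsGreatest {I : TwoSidedIdeal (FreeTwist θ) | IsClosed (I : Set (FreeTwist θ)) ∧ I ≠ ⊤}
        (defectIdeal θ) := by
  rw [FreeTwist.defectIdeal_eq_nullIdeal]
  exact ⟨fun I hI => FreeTwist.le_nullIdeal hθ hI,
    ⟨FreeTwist.isClosed_nullIdeal, FreeTwist.nullIdeal_ne_top⟩,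
    fun I hI => FreeTwist.le_nullIdeal hθ hI.2⟩
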